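/- For probability distribution functions $F,G$ on $\mathbb{R}$ let $$d_{AD}(F,G)=\int_{-\infty}^{\infty}\frac{(F(t)-G(t))^2}{G(t)(1-G(t))}\,dG(t)$$ be the Anderson–Darling distance. A random probability measure $P$ on $\mathbb{R}$ is a Dirichlet process with concentration parameter $a>0$ and base measure $H$, written $P\sim DP(a,H)$, if for every finite measurable partition $A_1,\dots,A_k$ of $\mathbb{R}$ with $k\ge 2$ the vector $(P(A_1),\dots,P(A_k))$ has the Dirichlet distribution with parameters $aH(A_1),\dots,aH(A_k)$ (a coordinate with parameter $0$ being almost surely $0$). A measure and its distribution function are denoted by the same letter. Let $m\ge 1$ be an integer and let $H=F_{(m)}$ be the chi-square distribution with $m$ degrees of freedom. For every $a>0$ let $P_a\sim DP(a,H)$, defined on some probability space (which may depend on $a$). Then for every $a>0$ the integral $d_{AD}(P_a,H)$ is almost surely finite and $d_{AD}(P_a,H)$ is a square-integrable random variable, and as $a\to\infty$: (i) $E\left[d_{AD}(P_a,H)\right]\to 0$ and $\mathrm{Var}\left[d_{AD}(P_a,H)\right]\to 0$; (ii) $E\left[(a+1)\,d_{AD}(P_a,H)\right]\to 1$ and $\mathrm{Var}\left[(a+1)\,d_{AD}(P_a,H)\right]\to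 \frac{2}{3}(\pi^2-9)$; (iii) $d_{AD}(P_a,H)\to 0$ in quadratic mean, i.e. $E\left[d_{AD}(P_a,H)^2\right]\to 0$. Moreover, for every $c>0$ and every sequence $(P_k)_{k\ge 1}$ of random probability measures on a common probability space with $P_k\sim DP(kc,H)$ for all $k\ge1$ (with arbitrary joint law), $d_{AD}(P_k,H)\to 0$ almost surely as $k\to\infty$. -/

import Mathlib

open MeasureTheory ProbabilityTheory Filter Topology
open scoped ENNReal

noncomputable section

/-- The gamma distribution with shape `α` and rate `1`, understood as the point mass at `0`
when the shape parameter is `0`. -/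
def gammaOrZero (α : ℝ) : Measure ℝ :=
  if 0 < α then gammaMeasure α 1 else Measure.dirac 0

instance (α : ℝ) : IsProbabilityMeasure (gammaOrZero α) := by
  unfold gammaOrZero
  split_ifs with h
  · exact isProbabilityMeasure_gammaMeasure h one_pos
  · infer_instance

/-- The Dirichlet distribution with parameters `α i ≥ 0`, not all zero: the law of
`(g₁ / S, …, g_k / S)`, where the `g_i` are independent, `g_i ∼ Gamma(α i, 1)`
(`g_i = 0` if `α i = 0`) and `S = g₁ + ⋯ + g_k`. -/
def dirichletMeasure {ι : Type*} [Fintype ι] (α : ι → ℝ) : Measure (ι → ℝ) :=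
  (Measure.pi fun i => gammaOrZero (α i)).map fun g i => g i / ∑ j, g j

/-- `P ∼ DP(a, H)`: the random probability measure `P` (a Markov kernel from the probability
space `(Ω, μ)` to `X`) is a Dirichlet process with concentration parameter `a` and base
measure `H`. -/
structure IsDirichletProcess {Ω X : Type*} [MeasurableSpace Ω] [MeasurableSpace X]
    (a : ℝ) (H : Measure X) (P : Kernel Ω X) (μ : Measure Ω) : Prop where
  isMarkovKernel : IsMarkovKernel P
  hasLaw_partition : ∀ (k : ℕ), 2 ≤ k → ∀ A : Fin k → Set X,
    (∀ i, MeasurableSet (A i)) → Pairwise (fun i j => Disjoint (A i) (A j)) →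
    (⋃ i, A i) = Set.univ →
    HasLaw (fun ω i => (P ω).real (A i)) (dirichletMeasure fun i => a * H.real (A i)) μ

/-- The chi-square distribution with `m` degrees of freedom, i.e. the law with density
`x ^ (m / 2 - 1) * exp (-x / 2) / (2 ^ (m / 2) * Γ(m / 2))` on `x > 0`. -/
def chiSquare (m : ℕ) : Measure ℝ := gammaMeasure ((m : ℝ) / 2) (1 / 2)

/-- The integrand of the Anderson-Darling distance between the cdf's `F` and `G`. -/
def adIntegrand (F G : ℝ → ℝ) (t : ℝ) : ℝ := (F t - G t) ^ 2 / (G t * (1 - G t))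

/-- The Anderson-Darling distance `∫ (F - G)² / (G (1 - G)) dG` between the cdf's `F` and `G`. -/
def adDist (F G : StieltjesFunction ℝ) : ℝ := ∫ t, adIntegrand F G t ∂G.measure

end

/-! The first two moments of the distance can be computed for every `a > 0`, up to one finite
constant that never has to be evaluated; all limits follow from these formulas.

Since `P(t) - H(t)` has variance `H(t)(1 - H(t))/(a + 1)`, the weight in the integrand cancels it
and the mean of the distance is exactly `1/(a + 1)`. For the second moment, Tonelli turns the square
into a double integral of a mixed fourth central moment, which depends only on a three-cell
Dirichlet vector. After division by the weights it equals `(a (1 + 2 covRatio) + 6 remRatio) / ((a +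
1)(a + 2)(a + 3))`. The leading term is the Gaussian one: for a Brownian bridge `B` with covariance
`u(1 - v)`, `u ≤ v`, one has `E[B_u² B_v²] = Var B_u · Var B_v + 2 Cov²`, and `covRatio` is the
squared correlation.

As `H` has no atoms, the probability integral transform replaces `H` by Lebesgue measure on `(0,
1)`. There `covRatio` integrates to `π²/3 - 3` (`lintegral_covRatio`) and `remRatio` has a finite
integral `remConst` (`lintegral_remRatio_ne_top`). Hence `(a + 1)²` times the second moment tends to
`1 + 2(π²/3 - 3) = 2π²/3 - 5`, and subtracting the squared mean gives `2/3 (π² - 9)`.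

Along `a = kc` the second moments are `O(k⁻²)`, hence summable, so the sum of the squared distances
is almost surely finite. This uses only the marginal laws. -/

/-! ### Gamma integrals and gamma laws -/

lemma gamma_add_nat {α : ℝ} (hα : 0 < α) (n : ℕ) :
    Real.Gamma (α + n) = (ascPochhammer ℝ n).eval α * Real.Gamma α := by
  induction n with
  | zero => simp
  | succ n ih =>
    rw [ascPochhammer_succ_eval, Nat.cast_succ, ← add_assoc, Real.Gamma_add_one (by positivity), ih]
    ring

lemma ascPochhammer_eval_nonneg {α : ℝ} (hα : 0 ≤ α) (n : ℕ) :
    0 ≤ (ascPochhammer ℝ n).eval α := by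
  induction n with
  | zero => simp
  | succ n ih => rw [ascPochhammer_succ_eval]; positivity

lemma lintegral_Ioi_rpow_mul_exp {α r : ℝ} (hα : 0 < α) (hr : 0 < r) :
    ∫⁻ x in Set.Ioi (0 : ℝ), ENNReal.ofReal (x ^ (α - 1) * Real.exp (-(r * x))) =
      ENNReal.ofReal ((1 / r) ^ α * Real.Gamma α) := by
  have h := Real.integral_rpow_mul_exp_neg_mul_Ioi hα hr
  rw [← h, ofReal_integral_eq_lintegral_ofReal]
  -- A non-integrable function has Bochner integral `0`, whereas the known value is positive.
  · by_contra hc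
    rw [integral_undef hc] at h
    have : 0 < (1 / r) ^ α * Real.Gamma α :=
      mul_pos (Real.rpow_pos_of_pos (by positivity) _) (Real.Gamma_pos_of_pos hα)
    linarith
  · filter_upwards [ae_restrict_mem measurableSet_Ioi] with x hx
    have : (0 : ℝ) < x := hx
    positivity

lemma lintegral_gammaMeasure {α r : ℝ} {f : ℝ → ℝ≥0∞}
    (hf : Measurable f) :
    ∫⁻ x, f x ∂gammaMeasure α r = ∫⁻ x in Set.Ioi (0 : ℝ),
      ENNReal.ofReal (r ^ α / Real.Gamma α * x ^ (α - 1) * Real.exp (-(r * x))) * f x := by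
  have hm : Measurable (gammaPDF α r) := (measurable_gammaPDFReal α r).ennreal_ofReal
  rw [gammaMeasure, lintegral_withDensity_eq_lintegral_mul _ hm hf,
    ← setLIntegral_univ, ← Set.Iio_union_Ici (a := (0 : ℝ)),
    lintegral_union measurableSet_Ici (Set.Iio_disjoint_Ici le_rfl),
    setLIntegral_congr_fun (g := 0) measurableSet_Iio
      (fun x hx => by simp [gammaPDF_of_neg (Set.mem_Iio.1 hx)]),
    setLIntegral_congr (Ioi_ae_eq_Ici (a := (0 : ℝ))).symm]
  simp only [Pi.zero_apply, lintegral_zero, zero_add]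
  refine setLIntegral_congr_fun measurableSet_Ioi fun x hx => ?_
  simp [gammaPDF_of_nonneg (le_of_lt (Set.mem_Ioi.1 hx))]

/-- The exponential tilt only changes the rate of the gamma density from `1` to `1 + s`. The
degenerate shape `0` obeys the same formula, because the rising factorial at `0` vanishes for `n >
0`. -/
lemma lintegral_gammaOrZero_pow_mul_exp {α s : ℝ} (hα : 0 ≤ α) (hs : 0 ≤ s) (n : ℕ) :
    ∫⁻ x, ENNReal.ofReal (x ^ n * Real.exp (-(s * x))) ∂gammaOrZero α =
      ENNReal.ofReal ((1 / (1 + s)) ^ (α + n) * (ascPochhammer ℝ n).eval α) := by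
  unfold gammaOrZero
  split_ifs with h
  · have hG := Real.Gamma_pos_of_pos h
    rw [lintegral_gammaMeasure (by fun_prop)]
    have : ∀ x ∈ Set.Ioi (0 : ℝ), ENNReal.ofReal (1 ^ α / Real.Gamma α * x ^ (α - 1) *
        Real.exp (-(1 * x))) * ENNReal.ofReal (x ^ n * Real.exp (-(s * x))) =
        ENNReal.ofReal (1 / Real.Gamma α) *
        ENNReal.ofReal (x ^ (α + n - 1) * Real.exp (-((1 + s) * x))) := by
      intro x hx
      have hx : (0 : ℝ) < x := hx
      rw [← ENNReal.ofReal_mul (by positivity), ← ENNReal.ofReal_mul (by positivity)]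
      congr 1
      rw [show α + n - 1 = α - 1 + n by ring, Real.rpow_add_natCast hx.ne',
        show -((1 + s) * x) = -(1 * x) + -(s * x) by ring, Real.exp_add, Real.one_rpow]
      ring
    rw [setLIntegral_congr_fun measurableSet_Ioi this, lintegral_const_mul _ (by fun_prop),
      lintegral_Ioi_rpow_mul_exp (by positivity) (by positivity),
      ← ENNReal.ofReal_mul (by positivity), gamma_add_nat h]
    congr 1
    field_simp
  · obtain rfl : α = 0 := le_antisymm (not_lt.1 h) hα
    rw [lintegral_dirac]
    rcases n with _ | n
    · simp
    · simp

lemma gammaOrZero_ae_nonneg (α : ℝ) : ∀ᵐ x ∂gammaOrZero α, 0 ≤ x := by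
  unfold gammaOrZero
  split_ifs with h
  · rw [ae_iff]
    have := lintegral_gammaMeasure (α := α) (r := 1) (f := Set.indicator (Set.Iio 0) 1)
      (measurable_one.indicator measurableSet_Iio)
    rw [lintegral_indicator_one measurableSet_Iio,
      setLIntegral_congr_fun (g := 0) measurableSet_Ioi] at this
    · simpa [Set.Iio_def] using this
    · intro x hx
      simp [le_of_lt (Set.mem_Ioi.1 hx)]
  · rw [ae_dirac_iff measurableSet_Ici]

lemma gammaOrZero_ae_pos {α : ℝ} (h : 0 < α) : ∀ᵐ x ∂gammaOrZero α, 0 < x := by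
  unfold gammaOrZero
  rw [if_pos h, ae_iff]
  have := lintegral_gammaMeasure (α := α) (r := 1) (f := Set.indicator (Set.Iic 0) 1)
    (measurable_one.indicator measurableSet_Iic)
  rw [lintegral_indicator_one measurableSet_Iic,
    setLIntegral_congr_fun (g := 0) measurableSet_Ioi] at this
  · simpa [Set.Iic_def] using this
  · intro x hx
    simp [Set.mem_Ioi.1 hx]

/-! ### Moments of the Dirichlet distribution -/

lemma lintegral_pi_prod {ι : Type*} [Fintype ι] {μ : ι → Measure ℝ}
    [∀ i, IsProbabilityMeasure (μ i)] {f : ι → ℝ → ℝ≥0∞} (hf : ∀ i, Measurable (f i)) :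
    ∫⁻ x, ∏ i, f i (x i) ∂Measure.pi μ = ∏ i, ∫⁻ x, f i x ∂μ i := by
  have h := iIndepFun_pi (μ := μ) (X := f) fun i => (hf i).aemeasurable
  rw [lintegral_prod_eq_prod_lintegral_of_indepFun Finset.univ _ h
    fun i => (hf i).comp (measurable_pi_apply i)]
  refine Finset.prod_congr rfl fun i _ => ?_
  rw [(measurePreserving_eval μ i).lintegral_comp (hf i)]

/-- The denominator couples the coordinates through `S = ∑ g j`. Writing `S⁻ᴺ = Γ(N)⁻¹ ∫ s^(N-1)
exp(-sS) ds` makes the integrand a product over coordinates, so independence applies for each fixed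
`s`. The remaining `s`-integral depends only on `N` and the total parameter. -/
lemma lintegral_normalized_gamma_monomial {ι : Type*} [Fintype ι] {α : ι → ℝ}
    (hα : ∀ i, 0 ≤ α i) (hA : 0 < ∑ i, α i) {n : ι → ℕ} (hn : 0 < ∑ i, n i) :
    ∫⁻ g, ENNReal.ofReal (∏ i, (g i / ∑ j, g j) ^ n i)
        ∂(Measure.pi fun i => gammaOrZero (α i)) =
      (∫⁻ s in Set.Ioi (0 : ℝ), ENNReal.ofReal (s ^ (((∑ i, n i : ℕ) : ℝ) - 1) /
        Real.Gamma (∑ i, n i : ℕ) * (1 / (1 + s)) ^ (∑ i, α i + (∑ i, n i : ℕ)))) *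
      ENNReal.ofReal (∏ i, (ascPochhammer ℝ (n i)).eval (α i)) := by
  set N := ∑ i, n i with hN
  have hN0 : (0 : ℝ) < N := by exact_mod_cast hn
  have hG := Real.Gamma_pos_of_pos hN0
  have hnn : ∀ᵐ g ∂(Measure.pi fun i => gammaOrZero (α i)), ∀ i, 0 ≤ g i :=
    ae_all_iff.2 fun i => (measurePreserving_eval (fun i => gammaOrZero (α i))
      i).quasiMeasurePreserving.ae (gammaOrZero_ae_nonneg (α i))
  -- One strictly positive parameter makes `S > 0` almost surely.
  obtain ⟨i₀, -, hi₀⟩ := Finset.exists_lt_of_sum_lt (s := Finset.univ) (f := fun _ => (0 : ℝ))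
    (g := α) (by simpa using hA)
  have hp : ∀ᵐ g ∂(Measure.pi fun i => gammaOrZero (α i)), 0 < g i₀ :=
    (measurePreserving_eval (fun i => gammaOrZero (α i))
      i₀).quasiMeasurePreserving.ae (gammaOrZero_ae_pos hi₀)
  calc
    _ = ∫⁻ g, (∫⁻ s in Set.Ioi (0 : ℝ), ENNReal.ofReal (s ^ ((N : ℝ) - 1) / Real.Gamma N) *
          ∏ i, ENNReal.ofReal (g i ^ n i * Real.exp (-(s * g i))))
          ∂(Measure.pi fun i => gammaOrZero (α i)) := by
      refine lintegral_congr_ae ?_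
      filter_upwards [hnn, hp] with g hg hg0
      have hS : 0 < ∑ j, g j := Finset.sum_pos' (fun i _ => hg i) ⟨i₀, Finset.mem_univ _, hg0⟩
      have hpr : 0 ≤ ∏ i, g i ^ n i := Finset.prod_nonneg fun i _ => pow_nonneg (hg i) _
      have : ∀ s ∈ Set.Ioi (0 : ℝ), ENNReal.ofReal (s ^ ((N : ℝ) - 1) / Real.Gamma N) *
          ∏ i, ENNReal.ofReal (g i ^ n i * Real.exp (-(s * g i))) =
          ENNReal.ofReal ((∏ i, g i ^ n i) / Real.Gamma N) *
          ENNReal.ofReal (s ^ ((N : ℝ) - 1) * Real.exp (-((∑ j, g j) * s))) := by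
        intro s hs
        have hs : (0 : ℝ) < s := hs
        rw [← ENNReal.ofReal_prod_of_nonneg
            fun i _ => mul_nonneg (pow_nonneg (hg i) _) (Real.exp_pos _).le,
          ← ENNReal.ofReal_mul (by positivity), ← ENNReal.ofReal_mul (by positivity),
          Finset.prod_mul_distrib, ← Real.exp_sum, Finset.sum_neg_distrib, ← Finset.mul_sum]
        congr 1
        rw [mul_comm s]
        ring
      rw [setLIntegral_congr_fun measurableSet_Ioi this, lintegral_const_mul _ (by fun_prop),
        lintegral_Ioi_rpow_mul_exp hN0 hS, ← ENNReal.ofReal_mul (by positivity)]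
      congr 1
      simp only [div_pow, Finset.prod_div_distrib, Finset.prod_pow_eq_pow_sum]
      rw [Real.rpow_natCast, ← hN, div_pow, one_pow]
      field_simp
    _ = ∫⁻ s in Set.Ioi (0 : ℝ), ∫⁻ g, ENNReal.ofReal (s ^ ((N : ℝ) - 1) / Real.Gamma N) *
          ∏ i, ENNReal.ofReal (g i ^ n i * Real.exp (-(s * g i)))
          ∂(Measure.pi fun i => gammaOrZero (α i)) := by
      refine lintegral_lintegral_swap (Measurable.aemeasurable ?_)
      simp only [Function.uncurry_def]
      refine Measurable.mul (by fun_prop) (Finset.measurable_fun_prod _ fun i _ => ?_)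
      fun_prop
    _ = _ := by
      rw [← lintegral_mul_const _ (by fun_prop)]
      refine setLIntegral_congr_fun measurableSet_Ioi fun s hs => ?_
      have hs : (0 : ℝ) < s := hs
      rw [lintegral_const_mul _ (Finset.measurable_fun_prod _ fun i _ => by fun_prop),
        lintegral_pi_prod (μ := fun i => gammaOrZero (α i))
          (f := fun i x => ENNReal.ofReal (x ^ n i * Real.exp (-(s * x)))) fun i => by fun_prop]
      simp only [lintegral_gammaOrZero_pow_mul_exp (hα _) hs.le]
      rw [← ENNReal.ofReal_prod_of_nonneg fun i _ =>
          mul_nonneg (by positivity) (ascPochhammer_eval_nonneg (hα i) _),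
        ← ENNReal.ofReal_mul (by positivity), ← ENNReal.ofReal_mul (by positivity),
        Finset.prod_mul_distrib, ← Real.rpow_sum_of_pos (by positivity),
        Finset.sum_add_distrib, ← Nat.cast_sum]
      congr 1
      ring

/-- No beta integral is computed: with a single coordinate the normalized vector is identically `1`,
so the preceding identity itself determines the constant. -/
lemma lintegral_beta_prime {A : ℝ} (hA : 0 < A) {N : ℕ} (hN : 0 < N) :
    (∫⁻ s in Set.Ioi (0 : ℝ), ENNReal.ofReal (s ^ ((N : ℝ) - 1) /
        Real.Gamma N * (1 / (1 + s)) ^ (A + N))) =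
      ENNReal.ofReal (1 / (ascPochhammer ℝ N).eval A) := by
  have h := lintegral_normalized_gamma_monomial (ι := Fin 1) (α := fun _ => A) (n := fun _ => N)
    (fun _ => hA.le) (by simpa) (by simpa)
  have h1 : ∫⁻ g, ENNReal.ofReal (∏ i : Fin 1, (g i / ∑ j, g j) ^ N)
        ∂(Measure.pi fun _ : Fin 1 => gammaOrZero A) = 1 := by
    have hp : ∀ᵐ g ∂(Measure.pi fun _ : Fin 1 => gammaOrZero A), 0 < g 0 :=
      (measurePreserving_eval (fun _ : Fin 1 => gammaOrZero A)
        0).quasiMeasurePreserving.ae (gammaOrZero_ae_pos hA)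
    rw [lintegral_congr_ae (g := fun _ => 1)]
    · simp
    · filter_upwards [hp] with g hg
      simp [hg.ne']
  have hr := ascPochhammer_pos N A hA
  simp only [Finset.univ_unique, Finset.sum_singleton, Finset.prod_singleton] at h h1
  rw [h1] at h
  rw [one_div, ENNReal.ofReal_inv_of_pos hr]
  exact ENNReal.eq_inv_of_mul_eq_one_left h.symm

lemma measurable_normalize {ι : Type*} [Fintype ι] :
    Measurable fun (g : ι → ℝ) i => g i / ∑ j, g j := by
  refine measurable_pi_lambda _ fun i => ?_
  exact (measurable_pi_apply i).div (Finset.measurable_fun_sum _ fun j _ => measurable_pi_apply j)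

lemma dirichletMeasure_ae_nonneg {ι : Type*} [Fintype ι] (α : ι → ℝ) :
    ∀ᵐ x ∂dirichletMeasure α, ∀ i, 0 ≤ x i := by
  have hnn : ∀ᵐ g ∂(Measure.pi fun i => gammaOrZero (α i)), ∀ i, 0 ≤ g i :=
    ae_all_iff.2 fun i => (measurePreserving_eval (fun i => gammaOrZero (α i))
      i).quasiMeasurePreserving.ae (gammaOrZero_ae_nonneg (α i))
  unfold dirichletMeasure
  rw [ae_map_iff measurable_normalize.aemeasurable]
  · filter_upwards [hnn] with g hg i
    exact div_nonneg (hg i) (Finset.sum_nonneg fun j _ => hg j)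
  · simp only [Set.ofPred_forall]
    exact MeasurableSet.iInter fun i => measurableSet_le measurable_const (measurable_pi_apply i)

instance {ι : Type*} [Fintype ι] (α : ι → ℝ) : IsProbabilityMeasure (dirichletMeasure α) :=
  Measure.isProbabilityMeasure_map measurable_normalize.aemeasurable

/-- The mixed moments of the Dirichlet distribution. -/
lemma lintegral_dirichletMeasure_monomial {ι : Type*} [Fintype ι] {α : ι → ℝ}
    (hα : ∀ i, 0 ≤ α i) (hA : 0 < ∑ i, α i) (n : ι → ℕ) :
    ∫⁻ x, ENNReal.ofReal (∏ i, x i ^ n i) ∂dirichletMeasure α =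
      ENNReal.ofReal ((∏ i, (ascPochhammer ℝ (n i)).eval (α i)) /
        (ascPochhammer ℝ (∑ i, n i)).eval (∑ i, α i)) := by
  rcases Nat.eq_zero_or_pos (∑ i, n i) with h0 | hn
  · have : ∀ i, n i = 0 := fun i => by simpa using Finset.sum_eq_zero_iff.1 h0 i
    simp [this]
  · have hm : Measurable fun x : ι → ℝ => ENNReal.ofReal (∏ i, x i ^ n i) :=
      ENNReal.measurable_ofReal.comp
        (Finset.measurable_fun_prod _ fun i _ => (measurable_pi_apply i).pow_const _)
    rw [dirichletMeasure, lintegral_map hm measurable_normalize,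
      lintegral_normalized_gamma_monomial hα hA hn,
      lintegral_beta_prime hA hn, ← ENNReal.ofReal_mul
        (one_div_nonneg.2 (ascPochhammer_pos _ _ hA).le)]
    congr 1
    ring

lemma integrable_dirichletMeasure_monomial {ι : Type*} [Fintype ι] {α : ι → ℝ}
    (hα : ∀ i, 0 ≤ α i) (hA : 0 < ∑ i, α i) (n : ι → ℕ) :
    Integrable (fun x => ∏ i, x i ^ n i) (dirichletMeasure α) := by
  refine (lintegral_ofReal_ne_top_iff_integrable (Measurable.aestronglyMeasurable
    (Finset.measurable_fun_prod _ fun i _ => (measurable_pi_apply i).pow_const _)) ?_).1 ?_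
  · filter_upwards [dirichletMeasure_ae_nonneg α] with x hx
    exact Finset.prod_nonneg fun i _ => pow_nonneg (hx i) _
  · rw [lintegral_dirichletMeasure_monomial hα hA]
    exact ENNReal.ofReal_ne_top

lemma integral_dirichletMeasure_monomial {ι : Type*} [Fintype ι] {α : ι → ℝ}
    (hα : ∀ i, 0 ≤ α i) (hA : 0 < ∑ i, α i) (n : ι → ℕ) :
    ∫ x, ∏ i, x i ^ n i ∂dirichletMeasure α =
      (∏ i, (ascPochhammer ℝ (n i)).eval (α i)) /
        (ascPochhammer ℝ (∑ i, n i)).eval (∑ i, α i) := by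
  rw [integral_eq_lintegral_of_nonneg_ae, lintegral_dirichletMeasure_monomial hα hA,
    ENNReal.toReal_ofReal]
  · exact div_nonneg (Finset.prod_nonneg fun i _ => ascPochhammer_eval_nonneg (hα i) _)
      (ascPochhammer_pos _ _ hA).le
  · filter_upwards [dirichletMeasure_ae_nonneg α] with x hx
    exact Finset.prod_nonneg fun i _ => pow_nonneg (hx i) _
  · exact (Finset.measurable_fun_prod _ fun i _ =>
      (measurable_pi_apply i).pow_const _).aestronglyMeasurable

lemma integral_dirichletMeasure_poly {α : Fin 3 → ℝ} (hα : ∀ i, 0 ≤ α i)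
    (hA : 0 < ∑ i, α i) {p q : ℕ} (c : Fin p → Fin q → ℝ) :
    ∫ x, ∑ i, ∑ j, c i j * (x 0 ^ (i : ℕ) * x 1 ^ (j : ℕ)) ∂dirichletMeasure α =
      ∑ i, ∑ j, c i j * ((ascPochhammer ℝ i).eval (α 0) * (ascPochhammer ℝ j).eval (α 1) /
        (ascPochhammer ℝ (i + j)).eval (∑ k, α k)) := by
  have hi : ∀ i j : ℕ, Integrable (fun x : Fin 3 → ℝ => x 0 ^ i * x 1 ^ j)
      (dirichletMeasure α) := fun i j => by
    simpa [Fin.prod_univ_three] using integrable_dirichletMeasure_monomial hα hA ![i, j, 0]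
  rw [integral_finsetSum _ fun i _ => integrable_finsetSum _ fun j _ => (hi _ _).const_mul _]
  refine Finset.sum_congr rfl fun i _ => ?_
  rw [integral_finsetSum _ fun j _ => (hi _ _).const_mul _]
  refine Finset.sum_congr rfl fun j _ => ?_
  rw [integral_const_mul]
  congr 1
  have := integral_dirichletMeasure_monomial hα hA ![i, j, 0]
  simpa [Fin.prod_univ_three, Fin.sum_univ_three (f := (![(i : ℕ), (j : ℕ), 0]))] using this

lemma integral_dirichletMeasure_sq {a u w z : ℝ} (ha : 0 < a) (hu : 0 ≤ u) (hw : 0 ≤ w)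
    (hz : 0 ≤ z) (h1 : u + w + z = 1) :
    ∫ x, (x 0 - u) ^ 2 ∂dirichletMeasure ![a * u, a * w, a * z] = u * (1 - u) / (a + 1) := by
  have hα : ∀ i, 0 ≤ ![a * u, a * w, a * z] i := by
    intro i; fin_cases i <;> simp <;> positivity
  have hs : ∑ i, ![a * u, a * w, a * z] i = a := by
    simp [Fin.sum_univ_three]; linear_combination a * h1
  have h := integral_dirichletMeasure_poly hα (hs.symm ▸ ha)
    (fun (i : Fin 3) (_ : Fin 1) => ![u ^ 2, -2 * u, 1] i)
  rw [hs] at h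
  simp only [Fin.sum_univ_three, Fin.sum_univ_one] at h
  simp [ascPochhammer_succ_eval] at h
  trans ∫ x, u ^ 2 + -(2 * u * x 0) + x 0 ^ 2 ∂dirichletMeasure ![a * u, a * w, a * z]
  · congr 1; ext x; ring
  · rw [h]; field_simp; ring

/-- The mixed fourth central moment of two nested partial sums of a Dirichlet vector. -/
lemma integral_dirichletMeasure_sq_mul_sq {a u w z : ℝ} (ha : 0 < a) (hu : 0 ≤ u) (hw : 0 ≤ w)
    (hz : 0 ≤ z) (h1 : u + w + z = 1) :
    ∫ x, (x 0 - u) ^ 2 * (x 0 + x 1 - (u + w)) ^ 2 ∂dirichletMeasure ![a * u, a * w, a * z] =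
      (a * (u * (1 - u) * ((u + w) * z) + 2 * u ^ 2 * z ^ 2) +
        6 * (u * (1 - u) ^ 2 * z ^ 2 + w * u ^ 2 * z ^ 2 + z * u ^ 2 * (u + w) ^ 2)) /
      ((a + 1) * (a + 2) * (a + 3)) := by
  have hα : ∀ i, 0 ≤ ![a * u, a * w, a * z] i := by
    intro i; fin_cases i <;> simp <;> positivity
  have hs : ∑ i, ![a * u, a * w, a * z] i = a := by
    simp [Fin.sum_univ_three]; linear_combination a * h1
  obtain rfl : z = 1 - u - w := by linarith
  have h := integral_dirichletMeasure_poly hα (hs.symm ▸ ha)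
    -- Entry `(i, j)` is the coefficient of `x 0 ^ i * x 1 ^ j` in the expanded product of squares.
    (![![u ^ 2 * (u + w) ^ 2, -2 * u ^ 2 * (u + w), u ^ 2],
      ![-2 * u * (u + w) ^ 2 - 2 * u ^ 2 * (u + w), 4 * u * (u + w) + 2 * u ^ 2, -2 * u],
      ![(u + w) ^ 2 + 4 * u * (u + w) + u ^ 2, -2 * (u + w) - 4 * u, 1],
      ![-2 * (u + w) - 2 * u, 2, 0], ![1, 0, 0]] : Fin 5 → Fin 3 → ℝ)
  rw [hs] at h
  simp only [Fin.sum_univ_three, Fin.sum_univ_five] at h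
  simp [ascPochhammer_succ_eval] at h
  refine Eq.trans ?_ (h.trans ?_)
  · congr 1; ext x; ring
  · field_simp; ring

/-! ### Moments of the Dirichlet process at one and two points -/

lemma abs_cdf_sub_le (ν κ : Measure ℝ) (t : ℝ) : |cdf ν t - cdf κ t| ≤ 1 := by
  rw [abs_le]
  constructor <;> linarith [cdf_nonneg ν t, cdf_le_one ν t, cdf_nonneg κ t, cdf_le_one κ t]

/-- The correlation-type ratio `u (1 - v) / ((1 - u) v)`, `u ≤ v`, of a Brownian bridge. -/
noncomputable def covRatio (u v : ℝ) : ℝ :=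
  min u v * (1 - max u v) / ((1 - min u v) * max u v)

/-- The lower order term in the mixed fourth moment of the standardized Dirichlet process. -/
noncomputable def remRatio (u v : ℝ) : ℝ :=
  (1 - min u v) * (1 - max u v) / max u v +
    (max u v - min u v) * min u v * (1 - max u v) / ((1 - min u v) * max u v) +
    min u v * max u v / (1 - min u v)

namespace IsDirichletProcess

variable {Ω : Type*} [MeasurableSpace Ω] {a : ℝ} {H : Measure ℝ}
  {P : Kernel Ω ℝ} {μ : Measure Ω}

lemma measurable_cdf_uncurry (hP : IsDirichletProcess a H P μ) :
    Measurable fun p : Ω × ℝ => cdf (P p.1) p.2 := by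
  have := hP.isMarkovKernel
  simp only [cdf_eq_real]
  have := Kernel.measurable_kernel_prodMk_left (κ := Kernel.prodMkRight ℝ P)
    (t := {q : (Ω × ℝ) × ℝ | q.2 ≤ q.1.2})
    (measurableSet_le measurable_snd (measurable_snd.comp measurable_fst))
  exact this.ennreal_toReal

lemma measurable_cdf (hP : IsDirichletProcess a H P μ) (t : ℝ) :
    Measurable fun ω => cdf (P ω) t :=
  hP.measurable_cdf_uncurry.comp (measurable_id.prodMk measurable_const)

/-- The joint law of the random distribution function at two points is read off this partition. The
case `s = t`, with an empty middle cell of parameter `0`, covers the one-point moments. -/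
lemma hasLaw_Iic_Ioc_Ioi [IsProbabilityMeasure H] (hP : IsDirichletProcess a H P μ) {s t : ℝ} (hst : s ≤ t) :
    HasLaw (fun ω i => (P ω).real (![Set.Iic s, Set.Ioc s t, Set.Ioi t] i))
      (dirichletMeasure ![a * cdf H s, a * (cdf H t - cdf H s), a * (1 - cdf H t)]) μ := by
  have h := hP.hasLaw_partition 3 (by norm_num) ![Set.Iic s, Set.Ioc s t, Set.Ioi t]
    (by intro i; fin_cases i <;> simp) (by
      intro i j hij
      fin_cases i <;> fin_cases j <;> simp_all [Set.disjoint_left] <;>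
        (intros; linarith)) (by
      ext x
      simp only [Set.mem_iUnion, Set.mem_univ, iff_true, Fin.exists_fin_succ]
      simp
      grind)
  convert h using 2
  ext i
  fin_cases i
  · simp [cdf_eq_real]
  · simp only [Fin.mk_one, Matrix.cons_val_one, Matrix.cons_val_zero, cdf_eq_real]
    rw [← Set.Iic_sdiff_Iic, measureReal_sdiff (Set.Iic_subset_Iic.2 hst) measurableSet_Iic]
  · simp only [Fin.reduceFinMk, Matrix.cons_val, cdf_eq_real]
    rw [← Set.compl_Iic, probReal_compl_eq_one_sub measurableSet_Iic]


lemma integral_cdf_sub_sq [IsProbabilityMeasure H] (hP : IsDirichletProcess a H P μ)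
    (ha : 0 < a) (t : ℝ) :
    ∫ ω, (cdf (P ω) t - cdf H t) ^ 2 ∂μ = cdf H t * (1 - cdf H t) / (a + 1) := by
  have := hP.isMarkovKernel
  rw [← integral_dirichletMeasure_sq ha (cdf_nonneg H t) (sub_self (cdf H t)).ge
    (sub_nonneg.2 (cdf_le_one H t)) (by ring), ← (hP.hasLaw_Iic_Ioc_Ioi le_rfl).integral_comp
    (Measurable.aestronglyMeasurable (by fun_prop))]
  congr 1
  ext ω
  simp [cdf_eq_real]

lemma integral_cdf_sub_sq_mul_sq [IsProbabilityMeasure H] (hP : IsDirichletProcess a H P μ)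
    (ha : 0 < a) {s t : ℝ} (hst : s ≤ t) :
    ∫ ω, (cdf (P ω) s - cdf H s) ^ 2 * (cdf (P ω) t - cdf H t) ^ 2 ∂μ =
      (a * (cdf H s * (1 - cdf H s) * (cdf H t * (1 - cdf H t)) +
          2 * cdf H s ^ 2 * (1 - cdf H t) ^ 2) +
        6 * (cdf H s * (1 - cdf H s) ^ 2 * (1 - cdf H t) ^ 2 +
          (cdf H t - cdf H s) * cdf H s ^ 2 * (1 - cdf H t) ^ 2 +
          (1 - cdf H t) * cdf H s ^ 2 * cdf H t ^ 2)) /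
      ((a + 1) * (a + 2) * (a + 3)) := by
  have := hP.isMarkovKernel
  have h := integral_dirichletMeasure_sq_mul_sq ha (cdf_nonneg H s)
    (sub_nonneg.2 (monotone_cdf H hst)) (sub_nonneg.2 (cdf_le_one H t)) (by ring)
  simp only [add_sub_cancel] at h
  rw [← h, ← (hP.hasLaw_Iic_Ioc_Ioi hst).integral_comp
    (Measurable.aestronglyMeasurable (by fun_prop))]
  congr 1
  ext ω
  have : (P ω).real (Set.Iic s) + (P ω).real (Set.Ioc s t) = (P ω).real (Set.Iic t) := by
    rw [← measureReal_union (by simp [Set.disjoint_left]; grind) measurableSet_Ioc,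
      Set.Iic_union_Ioc_eq_Iic hst]
  simp [cdf_eq_real, this]

lemma measurable_adIntegrand (hP : IsDirichletProcess a H P μ) :
    Measurable fun p : Ω × ℝ => adIntegrand (cdf (P p.1)) (cdf H) p.2 := by
  have h1 := hP.measurable_cdf_uncurry
  have h2 : Measurable fun p : Ω × ℝ => cdf H p.2 := (monotone_cdf H).measurable.comp measurable_snd
  unfold adIntegrand
  fun_prop

lemma lintegral_adIntegrand [IsProbabilityMeasure H] [IsProbabilityMeasure μ]
    (hP : IsDirichletProcess a H P μ) (ha : 0 < a) {t : ℝ} (h0 : 0 < cdf H t)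
    (h1 : cdf H t < 1) :
    ∫⁻ ω, ENNReal.ofReal (adIntegrand (cdf (P ω)) (cdf H) t) ∂μ = ENNReal.ofReal (1 / (a + 1)) := by
  have h1' : 0 < 1 - cdf H t := sub_pos.2 h1
  have hm := hP.measurable_cdf t
  rw [← ofReal_integral_eq_lintegral_ofReal]
  · simp only [adIntegrand]
    rw [integral_div, hP.integral_cdf_sub_sq ha]
    congr 1
    field_simp
  · refine Integrable.div_const (Integrable.of_bound (C := 1)
      (Measurable.aestronglyMeasurable (by fun_prop)) (ae_of_all _ fun ω => ?_)) _
    rw [Real.norm_eq_abs, abs_pow]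
    exact pow_le_one₀ (abs_nonneg _) (abs_cdf_sub_le _ _ _)
  · exact ae_of_all _ fun ω => div_nonneg (sq_nonneg _) (by positivity)

/-- Dividing the mixed fourth moment by both weights leaves a function of `cdf H s` and `cdf H t`
alone, which is what permits the later change of variables to the unit square. -/
lemma lintegral_adIntegrand_mul_adIntegrand [IsProbabilityMeasure H] [IsProbabilityMeasure μ]
    (hP : IsDirichletProcess a H P μ) (ha : 0 < a) {s t : ℝ} (hs0 : 0 < cdf H s)
    (hs1 : cdf H s < 1) (ht0 : 0 < cdf H t) (ht1 : cdf H t < 1) :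
    ∫⁻ ω, ENNReal.ofReal (adIntegrand (cdf (P ω)) (cdf H) s) *
        ENNReal.ofReal (adIntegrand (cdf (P ω)) (cdf H) t) ∂μ =
      ENNReal.ofReal ((a * (1 + 2 * covRatio (cdf H s) (cdf H t)) +
        6 * remRatio (cdf H s) (cdf H t)) / ((a + 1) * (a + 2) * (a + 3))) := by
  wlog hst : s ≤ t generalizing s t
  · have := this ht0 ht1 hs0 hs1 (not_le.1 hst).le
    simp only [covRatio, remRatio] at this ⊢
    rw [min_comm, max_comm, ← this]
    simp only [mul_comm]
  have hs1' : 0 < 1 - cdf H s := sub_pos.2 hs1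
  have ht1' : 0 < 1 - cdf H t := sub_pos.2 ht1
  have hms := hP.measurable_cdf s
  have hmt := hP.measurable_cdf t
  have hnn : ∀ ω, 0 ≤ adIntegrand (cdf (P ω)) (cdf H) s := fun ω =>
    div_nonneg (sq_nonneg _) (by positivity)
  have hnn' : ∀ ω, 0 ≤ adIntegrand (cdf (P ω)) (cdf H) t := fun ω =>
    div_nonneg (sq_nonneg _) (by positivity)
  simp only [← ENNReal.ofReal_mul (hnn _)]
  rw [← ofReal_integral_eq_lintegral_ofReal]
  · simp only [adIntegrand, div_mul_div_comm]
    rw [integral_div, hP.integral_cdf_sub_sq_mul_sq ha hst, covRatio, remRatio,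
      min_eq_left (monotone_cdf H hst), max_eq_right (monotone_cdf H hst)]
    congr 1
    field_simp
  · simp only [adIntegrand, div_mul_div_comm]
    refine Integrable.div_const (Integrable.of_bound (C := 1)
      (Measurable.aestronglyMeasurable (by fun_prop)) (ae_of_all _ fun ω => ?_)) _
    rw [Real.norm_eq_abs, abs_mul, abs_pow, abs_pow]
    exact mul_le_one₀ (pow_le_one₀ (abs_nonneg _) (abs_cdf_sub_le _ _ _)) (by positivity)
      (pow_le_one₀ (abs_nonneg _) (abs_cdf_sub_le _ _ _))
  · exact ae_of_all _ fun ω => mul_nonneg (hnn ω) (hnn' ω)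

end IsDirichletProcess

/-! ### Probability integral transform -/

lemma continuous_cdf_of_nullSingletonClass (H : Measure ℝ) [IsProbabilityMeasure H] [NullSingletonClass H] :
    Continuous (cdf H) := by
  have hnull : ∀ x, (cdf H).measure {x} = 0 := fun x => by rw [measure_cdf]; exact measure_singleton x
  refine continuous_iff_continuousAt.2 fun x => ?_
  have h := hnull x
  rw [StieltjesFunction.measure_singleton, ENNReal.ofReal_eq_zero] at h
  rw [(monotone_cdf H).continuousAt_iff_leftLim_eq_rightLim, (cdf H).rightLim_eq]
  exact le_antisymm ((monotone_cdf H).leftLim_le le_rfl) (by linarith)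

/-- The probability integral transform. -/
lemma map_cdf_of_nullSingletonClass (H : Measure ℝ) [IsProbabilityMeasure H] [NullSingletonClass H] :
    H.map (cdf H) = volume.restrict (Set.Ioo 0 1) := by
  have hm : Measurable (cdf H) := (monotone_cdf H).measurable
  have : IsProbabilityMeasure (H.map (cdf H)) := Measure.isProbabilityMeasure_map hm.aemeasurable
  have : IsProbabilityMeasure (volume.restrict (Set.Ioo (0 : ℝ) 1)) := ⟨by simp⟩
  have hc := continuous_cdf_of_nullSingletonClass H
  refine Measure.ext_of_Iic _ _ fun x => ?_
  rw [Measure.map_apply hm measurableSet_Iic, Measure.restrict_apply measurableSet_Iic]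
  rcases lt_or_ge x 1 with h1 | h1
  swap
  · have e1 : cdf H ⁻¹' Set.Iic x = Set.univ := Set.eq_univ_of_forall fun t => (cdf_le_one H t).trans h1
    have e2 : Set.Iic x ∩ Set.Ioo 0 1 = Set.Ioo 0 1 :=
      Set.inter_eq_right.2 fun t ht => ht.2.le.trans h1
    rw [e1, e2]
    simp
  have hR : volume (Set.Iic x ∩ Set.Ioo 0 1) = ENNReal.ofReal x := by
    have : Set.Iic x ∩ Set.Ioo 0 1 = Set.Ioc 0 x := by
      ext t; simp only [Set.mem_inter_iff, Set.mem_Iic, Set.mem_Ioo, Set.mem_Ioc]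
      constructor
      · rintro ⟨a, b, c⟩; exact ⟨b, a⟩
      · rintro ⟨a, b⟩; exact ⟨b, a, b.trans_lt h1⟩
    rw [this]; simp
  rw [hR]
  have hb : BddAbove (cdf H ⁻¹' Set.Iic x) := by
    obtain ⟨t, ht⟩ := ((tendsto_cdf_atTop H).eventually (lt_mem_nhds h1)).exists
    exact ⟨t, fun s hs => le_of_not_gt fun hts => by
      have := monotone_cdf H hts.le
      have : cdf H s ≤ x := hs
      linarith⟩
  rcases Set.eq_empty_or_nonempty (cdf H ⁻¹' Set.Iic x) with he | hne
  · rw [he, measure_empty, eq_comm, ENNReal.ofReal_eq_zero]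
    by_contra! h0
    obtain ⟨t, ht⟩ := ((tendsto_cdf_atBot H).eventually (gt_mem_nhds h0)).exists
    have : t ∈ cdf H ⁻¹' Set.Iic x := le_of_lt ht
    simp [he] at this
  -- `T` is the largest point where the distribution function is at most `x`. To its right the
  -- values exceed `x`, so continuity forces the value `x` at `T`.
  · set T := sSup (cdf H ⁻¹' Set.Iic x) with hT
    have hTm : cdf H T ≤ x := (isClosed_Iic.preimage hc).csSup_mem hne hb
    have hset : cdf H ⁻¹' Set.Iic x = Set.Iic T := by
      ext s
      exact ⟨fun hs => le_csSup hb hs, fun hs => (monotone_cdf H hs).trans hTm⟩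
    rw [hset, ← ofReal_cdf]
    congr 1
    refine le_antisymm hTm ?_
    refine ge_of_tendsto (hc.continuousAt.tendsto.mono_left (nhdsWithin_le_nhds (s := Set.Ioi T))) ?_
    filter_upwards [self_mem_nhdsWithin] with s hs
    by_contra! h
    exact (not_le.2 (Set.mem_Ioi.1 hs)) (le_csSup hb h.le)

/-! ### Integral of the squared correlation over the unit square -/

lemma setLIntegral_Ioo_pow {v : ℝ} (hv : 0 ≤ v) (k : ℕ) :
    ∫⁻ u in Set.Ioo 0 v, ENNReal.ofReal (u ^ k) = ENNReal.ofReal (v ^ (k + 1) / (k + 1)) := by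
  have h : IntervalIntegrable (fun u : ℝ => u ^ k) volume 0 v :=
    (continuous_pow k).intervalIntegrable _ _
  have h2 := (intervalIntegrable_iff_integrableOn_Ioo_of_le hv).1 h
  rw [← ofReal_integral_eq_lintegral_ofReal h2, ← integral_Ioc_eq_integral_Ioo,
    ← intervalIntegral.integral_of_le hv, integral_pow]
  · simp
  · filter_upwards [ae_restrict_mem measurableSet_Ioo] with u hu
    exact pow_nonneg hu.1.le _

/-- Each term is `1/(n+2)² - 1/((n+2)(n+3))`: the Basel series without its first term, `π²/6 - 1`,
minus a telescoping series with sum `1/2`. -/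
lemma hasSum_covRatio_aux :
    HasSum (fun n : ℕ => (1 : ℝ) / (n + 2) * (1 / (n + 2) - 1 / (n + 3))) (Real.pi ^ 2 / 6 - 3 / 2) := by
  have h1 : HasSum (fun n : ℕ => (1 : ℝ) / ((n : ℝ) + 2) ^ 2) (Real.pi ^ 2 / 6 - 1) := by
    have := (hasSum_nat_add_iff' 2).2 hasSum_zeta_two
    simpa [Finset.sum_range_succ] using this
  have h2 : HasSum (fun n : ℕ => (1 : ℝ) / (((n : ℝ) + 2) * (n + 3))) (1 / 2) := by
    rw [hasSum_iff_tendsto_nat_of_nonneg fun n => by positivity]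
    have hs : ∀ N : ℕ, ∑ n ∈ Finset.range N, (1 : ℝ) / (((n : ℝ) + 2) * (n + 3)) =
        1 / 2 - 1 / ((N : ℝ) + 2) := by
      intro N
      induction N with
      | zero => simp
      | succ N ih =>
        rw [Finset.sum_range_succ, ih]
        push_cast
        have : (N : ℝ) + 1 + 2 ≠ 0 := by positivity
        field_simp
        ring
    simp only [hs]
    have : Tendsto (fun N : ℕ => 1 / ((N : ℝ) + 2)) atTop (𝓝 0) := by
      simp only [one_div]
      exact (tendsto_natCast_atTop_atTop.atTop_add tendsto_const_nhds).inv_tendsto_atTop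
    simpa using tendsto_const_nhds.sub this
  have h := h1.sub h2
  have e : ∀ n : ℕ, (1 : ℝ) / (n + 2) * (1 / (n + 2) - 1 / (n + 3)) =
      1 / ((n : ℝ) + 2) ^ 2 - 1 / (((n : ℝ) + 2) * (n + 3)) := fun n => by field_simp
  rw [show Real.pi ^ 2 / 6 - 3 / 2 = Real.pi ^ 2 / 6 - 1 - 1 / 2 by ring]
  simpa only [e] using h

lemma measurable_covRatio : Measurable fun p : ℝ × ℝ => covRatio p.1 p.2 := by
  unfold covRatio; fun_prop

lemma measurable_remRatio : Measurable fun p : ℝ × ℝ => remRatio p.1 p.2 := by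
  unfold remRatio; fun_prop

/-- For `u < v` the factor `1/(1 - u)` is expanded as a geometric series and integrated termwise;
nonnegativity justifies the interchange. -/
lemma setLIntegral_covRatio_Ioo {v : ℝ} (hv : v ∈ Set.Ioo (0 : ℝ) 1) :
    ∫⁻ u in Set.Ioo 0 v, ENNReal.ofReal (covRatio u v) =
      ∑' n : ℕ, ENNReal.ofReal (1 / (n + 2)) * ENNReal.ofReal (v ^ (n + 1) - v ^ (n + 2)) := by
  have h1 : ∀ u ∈ Set.Ioo 0 v, ENNReal.ofReal (covRatio u v) =
      ∑' n : ℕ, ENNReal.ofReal ((1 - v) / v) * ENNReal.ofReal (u ^ (n + 1)) := by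
    intro u hu
    have hv0 := hv.1
    have hv1 : 0 < 1 - v := sub_pos.2 hv.2
    have hu1 : 0 < 1 - u := by linarith [hu.2, hv.2]
    have hsum := (hasSum_geometric_of_lt_one hu.1.le (by linarith)).mul_left ((1 - v) / v * u)
    rw [covRatio, min_eq_left hu.2.le, max_eq_right hu.2.le,
      show u * (1 - v) / ((1 - u) * v) = (1 - v) / v * u * (1 - u)⁻¹ by field_simp,
      ← hsum.tsum_eq, ENNReal.ofReal_tsum_of_nonneg _ hsum.summable]
    · refine tsum_congr fun n => ?_
      rw [← ENNReal.ofReal_mul (by positivity)]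
      congr 1; ring
    · intro n
      have := hu.1
      positivity
  rw [setLIntegral_congr_fun measurableSet_Ioo h1, lintegral_tsum fun n => by fun_prop]
  refine tsum_congr fun n => ?_
  have hv0 := hv.1
  have hv1 : 0 < 1 - v := sub_pos.2 hv.2
  rw [lintegral_const_mul _ (by fun_prop), setLIntegral_Ioo_pow hv.1.le,
    ← ENNReal.ofReal_mul (by positivity), ← ENNReal.ofReal_mul (by positivity)]
  congr 1
  push_cast
  field_simp
  ring

lemma lintegral_setLIntegral_covRatio :
    ∫⁻ v in Set.Ioo (0 : ℝ) 1, ∫⁻ u in Set.Ioo 0 v, ENNReal.ofReal (covRatio u v) =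
      ENNReal.ofReal (Real.pi ^ 2 / 6 - 3 / 2) := by
  rw [setLIntegral_congr_fun measurableSet_Ioo fun v hv => setLIntegral_covRatio_Ioo hv,
    lintegral_tsum fun n => by fun_prop, ← hasSum_covRatio_aux.tsum_eq,
    ENNReal.ofReal_tsum_of_nonneg _ hasSum_covRatio_aux.summable]
  · refine tsum_congr fun n => ?_
    rw [lintegral_const_mul _ (by fun_prop), ENNReal.ofReal_mul (by positivity)]
    congr 1
    have hi : ∀ k : ℕ, Integrable (fun v : ℝ => v ^ k) (volume.restrict (Set.Ioo (0 : ℝ) 1)) :=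
      fun k => (intervalIntegrable_iff_integrableOn_Ioo_of_le zero_le_one).1
        ((continuous_pow k).intervalIntegrable _ _)
    have hsub : Integrable (fun v : ℝ => v ^ (n + 1) - v ^ (n + 2))
        (volume.restrict (Set.Ioo (0 : ℝ) 1)) := (hi _).sub (hi _)
    rw [← ofReal_integral_eq_lintegral_ofReal hsub, integral_sub (hi _) (hi _),
      ← integral_Ioc_eq_integral_Ioo, ← integral_Ioc_eq_integral_Ioo,
      ← intervalIntegral.integral_of_le zero_le_one, ← intervalIntegral.integral_of_le zero_le_one,
      integral_pow, integral_pow]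
    · congr 1
      norm_num
      ring
    · filter_upwards [ae_restrict_mem measurableSet_Ioo] with u hu
      exact sub_nonneg.2 (pow_le_pow_of_le_one hu.1.le hu.2.le (by omega))
  · intro n
    have : (1 : ℝ) / (n + 3) ≤ 1 / (n + 2) := by gcongr; norm_num
    exact mul_nonneg (by positivity) (sub_nonneg.2 this)

/-- By symmetry, the square contributes twice the triangle `u < v`, the diagonal being null. -/
lemma lintegral_covRatio :
    ∫⁻ u in Set.Ioo (0 : ℝ) 1, ∫⁻ v in Set.Ioo (0 : ℝ) 1, ENNReal.ofReal (covRatio u v) =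
      ENNReal.ofReal (Real.pi ^ 2 / 3 - 3) := by
  set f : ℝ → ℝ → ℝ≥0∞ := fun u v => (Set.Iio v).indicator
    (fun u => ENNReal.ofReal (covRatio u v)) u with hf
  have hfm : Measurable (Function.uncurry f) := by
    have : Function.uncurry f = {p : ℝ × ℝ | p.1 < p.2}.indicator
        fun p => ENNReal.ofReal (covRatio p.1 p.2) := by
      ext ⟨u, v⟩; simp [f, Set.indicator]
    rw [this]
    exact measurable_covRatio.ennreal_ofReal.indicator (measurableSet_lt measurable_fst measurable_snd)
  have hint : ∫⁻ v in Set.Ioo (0 : ℝ) 1, ∫⁻ u in Set.Ioo (0 : ℝ) 1, f u v =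
      ENNReal.ofReal (Real.pi ^ 2 / 6 - 3 / 2) := by
    rw [← lintegral_setLIntegral_covRatio]
    refine setLIntegral_congr_fun measurableSet_Ioo fun v hv => ?_
    simp only [f]
    rw [lintegral_indicator measurableSet_Iio, Measure.restrict_restrict measurableSet_Iio]
    congr 2
    ext u
    simp only [Set.mem_inter_iff, Set.mem_Iio, Set.mem_Ioo]
    exact ⟨fun h => ⟨h.2.1, h.1⟩, fun h => ⟨h.2, h.1, h.2.trans hv.2⟩⟩
  have hsplit : ∀ u, ∫⁻ v in Set.Ioo (0 : ℝ) 1, ENNReal.ofReal (covRatio u v) =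
      (∫⁻ v in Set.Ioo (0 : ℝ) 1, f u v) + ∫⁻ v in Set.Ioo (0 : ℝ) 1, f v u := by
    intro u
    have hfu : Measurable (f u) := hfm.comp measurable_prodMk_left
    rw [← lintegral_add_left hfu]
    refine lintegral_congr_ae ?_
    filter_upwards [Measure.ae_ne (volume.restrict (Set.Ioo (0 : ℝ) 1)) u] with v hv
    have hc : covRatio v u = covRatio u v := by simp [covRatio, min_comm, max_comm]
    rcases lt_or_gt_of_ne hv with h | h
    · simp [f, h, h.le, hc]
    · simp [f, h, h.le]
  have hfi : Measurable fun u => ∫⁻ v in Set.Ioo (0 : ℝ) 1, f u v := hfm.lintegral_prod_right'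
  simp only [hsplit]
  rw [lintegral_add_left hfi, lintegral_lintegral_swap hfm.aemeasurable, hint,
    ← ENNReal.ofReal_add]
  · congr 1; ring
  · have := Real.pi_gt_three; nlinarith
  · have := Real.pi_gt_three; nlinarith

/-! ### Integrability of the lower order term -/

lemma covRatio_nonneg {u v : ℝ} (hu : u ∈ Set.Ioo (0 : ℝ) 1) (hv : v ∈ Set.Ioo (0 : ℝ) 1) :
    0 ≤ covRatio u v := by
  have h0 : 0 < min u v := lt_min hu.1 hv.1
  have h1 : 0 < 1 - max u v := sub_pos.2 (max_lt hu.2 hv.2)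
  have h2 : 0 < max u v := lt_max_of_lt_left hu.1
  have h3 : 0 < 1 - min u v := sub_pos.2 (min_lt_of_left_lt hu.2)
  unfold covRatio; positivity

lemma remRatio_nonneg {u v : ℝ} (hu : u ∈ Set.Ioo (0 : ℝ) 1) (hv : v ∈ Set.Ioo (0 : ℝ) 1) :
    0 ≤ remRatio u v := by
  have h0 : 0 < min u v := lt_min hu.1 hv.1
  have h1 : 0 < 1 - max u v := sub_pos.2 (max_lt hu.2 hv.2)
  have h2 : 0 < max u v := lt_max_of_lt_left hu.1
  have h3 : 0 < 1 - min u v := sub_pos.2 (min_lt_of_left_lt hu.2)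
  have h4 : 0 ≤ max u v - min u v := sub_nonneg.2 min_le_max
  unfold remRatio; positivity

/-- The singularities are `1/max u v` and `1/(1 - min u v)`. Splitting each as a product of two
inverse square roots and replacing one by the larger value at the other variable gives a bound by
separable terms, integrable since the exponent exceeds `-1`. -/
lemma remRatio_le {u v : ℝ} (hu : u ∈ Set.Ioo (0 : ℝ) 1) (hv : v ∈ Set.Ioo (0 : ℝ) 1) :
    remRatio u v ≤ u ^ (-1 / 2 : ℝ) * v ^ (-1 / 2 : ℝ) + 1 +
      (1 - u) ^ (-1 / 2 : ℝ) * (1 - v) ^ (-1 / 2 : ℝ) := by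
  wlog h : u ≤ v generalizing u v
  · have := this hv hu (not_le.1 h).le
    simp only [remRatio] at this ⊢
    rw [min_comm, max_comm]
    linarith
  have hu0 := hu.1
  have hv0 := hv.1
  have hu1 : 0 < 1 - u := sub_pos.2 hu.2
  have hv1 : 0 < 1 - v := sub_pos.2 hv.2
  have hinv : ∀ x : ℝ, 0 < x → x⁻¹ = x ^ (-1 / 2 : ℝ) * x ^ (-1 / 2 : ℝ) := fun x hx => by
    rw [← Real.rpow_add hx, ← Real.rpow_neg_one]; norm_num
  rw [remRatio, min_eq_left h, max_eq_right h]
  have e1 : (1 - u) * (1 - v) / v ≤ u ^ (-1 / 2 : ℝ) * v ^ (-1 / 2 : ℝ) := by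
    calc (1 - u) * (1 - v) / v ≤ 1 / v := by
          gcongr; nlinarith
      _ = v ^ (-1 / 2 : ℝ) * v ^ (-1 / 2 : ℝ) := by rw [one_div, hinv v hv0]
      _ ≤ _ := by
          gcongr ?_ * _
          exact Real.rpow_le_rpow_of_nonpos hu0 h (by norm_num)
  have e2 : (v - u) * u * (1 - v) / ((1 - u) * v) ≤ 1 := by
    rw [div_le_one (by positivity)]
    have : (v - u) * (1 - v) ≤ 1 - u := by nlinarith
    nlinarith [mul_le_mul this h hu0.le hu1.le]
  have e3 : u * v / (1 - u) ≤ (1 - u) ^ (-1 / 2 : ℝ) * (1 - v) ^ (-1 / 2 : ℝ) := by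
    calc u * v / (1 - u) ≤ 1 / (1 - u) := by
          gcongr; nlinarith
      _ = (1 - u) ^ (-1 / 2 : ℝ) * (1 - u) ^ (-1 / 2 : ℝ) := by rw [one_div, hinv _ hu1]
      _ ≤ _ := by
          gcongr _ * ?_
          exact Real.rpow_le_rpow_of_nonpos hv1 (by linarith) (by norm_num)
  linarith

lemma lintegral_remRatio_ne_top :
    ∫⁻ u in Set.Ioo (0 : ℝ) 1, ∫⁻ v in Set.Ioo (0 : ℝ) 1, ENNReal.ofReal (remRatio u v) ≠ ⊤ := by
  set g : ℝ → ℝ≥0∞ := fun u => ENNReal.ofReal (u ^ (-1 / 2 : ℝ)) with hg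
  set k : ℝ → ℝ≥0∞ := fun u => ENNReal.ofReal ((1 - u) ^ (-1 / 2 : ℝ)) with hk
  have hgm : Measurable g := by fun_prop
  have hkm : Measurable k := by fun_prop
  have h0 := intervalIntegral.intervalIntegrable_rpow' (a := 0) (b := 1) (r := -1 / 2) (by norm_num)
  have hgi : ∫⁻ u in Set.Ioo (0 : ℝ) 1, g u ≠ ⊤ :=
    (Integrable.lintegral_lt_top
      ((intervalIntegrable_iff_integrableOn_Ioo_of_le zero_le_one).1 h0)).ne
  have hki : ∫⁻ u in Set.Ioo (0 : ℝ) 1, k u ≠ ⊤ := by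
    have h1 := (h0.comp_sub_left 1).symm
    simp only [sub_self, sub_zero] at h1
    exact (Integrable.lintegral_lt_top
      ((intervalIntegrable_iff_integrableOn_Ioo_of_le zero_le_one).1 h1)).ne
  refine ne_top_of_le_ne_top (b := (∫⁻ u in Set.Ioo (0 : ℝ) 1, g u) *
    (∫⁻ u in Set.Ioo (0 : ℝ) 1, g u) + 1 + (∫⁻ u in Set.Ioo (0 : ℝ) 1, k u) *
    (∫⁻ u in Set.Ioo (0 : ℝ) 1, k u)) (by finiteness) ?_
  calc _ ≤ ∫⁻ u in Set.Ioo (0 : ℝ) 1, ∫⁻ v in Set.Ioo (0 : ℝ) 1, (g u * g v + 1 + k u * k v) := by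
        refine setLIntegral_mono' measurableSet_Ioo fun u hu =>
          setLIntegral_mono' measurableSet_Ioo fun v hv => ?_
        have hu1 : 0 < 1 - u := sub_pos.2 hu.2
        have hv1 : 0 < 1 - v := sub_pos.2 hv.2
        have hu0 := hu.1
        have hv0 := hv.1
        simp only [g, k]
        rw [← ENNReal.ofReal_mul (by positivity), ← ENNReal.ofReal_mul (by positivity),
          ← ENNReal.ofReal_one, ← ENNReal.ofReal_add (by positivity) (by positivity),
          ← ENNReal.ofReal_add (by positivity) (by positivity)]
        exact ENNReal.ofReal_le_ofReal (remRatio_le hu hv)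
    _ = _ := by
        have : ∀ u, ∫⁻ v in Set.Ioo (0 : ℝ) 1, (g u * g v + 1 + k u * k v) =
            g u * (∫⁻ v in Set.Ioo (0 : ℝ) 1, g v) + 1 +
              k u * ∫⁻ v in Set.Ioo (0 : ℝ) 1, k v := by
          intro u
          rw [lintegral_add_right _ (by fun_prop), lintegral_add_right _ (by fun_prop),
            lintegral_const_mul _ hgm, lintegral_const_mul _ hkm]
          simp
        simp only [this]
        rw [lintegral_add_right _ (by fun_prop), lintegral_add_right _ (by fun_prop),
          lintegral_mul_const _ hgm, lintegral_mul_const _ hkm]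
        simp

/-! ### Moments of the distance -/

lemma adIntegrand_cdf_nonneg (ν H : Measure ℝ) (t : ℝ) : 0 ≤ adIntegrand (cdf ν) (cdf H) t :=
  div_nonneg (sq_nonneg _) (mul_nonneg (cdf_nonneg H t) (sub_nonneg.2 (cdf_le_one H t)))

lemma measurable_adIntegrand_cdf (ν H : Measure ℝ) :
    Measurable (adIntegrand (cdf ν) (cdf H)) := by
  have h1 := (monotone_cdf ν).measurable
  have h2 := (monotone_cdf H).measurable
  unfold adIntegrand
  fun_prop

/-- This needs no integrability: if the integral diverges, both sides take the default value `0`.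
Almost sure finiteness therefore has to be proved separately. -/
lemma adDist_cdf_eq_toReal (ν H : Measure ℝ) [IsProbabilityMeasure H] :
    adDist (cdf ν) (cdf H) =
      (∫⁻ t, ENNReal.ofReal (adIntegrand (cdf ν) (cdf H) t) ∂H).toReal := by
  rw [adDist, measure_cdf, integral_eq_lintegral_of_nonneg_ae
    (ae_of_all _ (adIntegrand_cdf_nonneg ν H)) (measurable_adIntegrand_cdf ν H).aestronglyMeasurable]

lemma ae_cdf_mem_Ioo (H : Measure ℝ) [IsProbabilityMeasure H] [NullSingletonClass H] :
    ∀ᵐ t ∂H, cdf H t ∈ Set.Ioo 0 1 := by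
  have h : ∀ᵐ u ∂(H.map (cdf H)), u ∈ Set.Ioo (0 : ℝ) 1 := by
    rw [map_cdf_of_nullSingletonClass]
    exact ae_restrict_mem measurableSet_Ioo
  exact ae_of_ae_map (monotone_cdf H).measurable.aemeasurable h

lemma lintegral_lintegral_comp_cdf (H : Measure ℝ) [IsProbabilityMeasure H]
    [NullSingletonClass H] {f : ℝ × ℝ → ℝ≥0∞} (hf : Measurable f) :
    ∫⁻ s, ∫⁻ t, f (cdf H s, cdf H t) ∂H ∂H =
      ∫⁻ u in Set.Ioo (0 : ℝ) 1, ∫⁻ v in Set.Ioo (0 : ℝ) 1, f (u, v) := by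
  have hm := (monotone_cdf H).measurable
  rw [← map_cdf_of_nullSingletonClass H, lintegral_map hf.lintegral_prod_right' hm]
  refine lintegral_congr fun s => ?_
  exact (lintegral_map (hf.comp (measurable_prodMk_left (x := cdf H s))) hm).symm

/-- The constant governing the lower order term of the second moment. -/
noncomputable def remConst : ℝ :=
  (∫⁻ u in Set.Ioo (0 : ℝ) 1, ∫⁻ v in Set.Ioo (0 : ℝ) 1, ENNReal.ofReal (remRatio u v)).toReal

lemma lintegral_covRatio_remRatio {a : ℝ} (ha : 0 < a) :
    ∫⁻ u in Set.Ioo (0 : ℝ) 1, ∫⁻ v in Set.Ioo (0 : ℝ) 1,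
      ENNReal.ofReal ((a * (1 + 2 * covRatio u v) + 6 * remRatio u v) /
        ((a + 1) * (a + 2) * (a + 3))) =
    ENNReal.ofReal ((a * (2 / 3 * Real.pi ^ 2 - 5) + 6 * remConst) /
      ((a + 1) * (a + 2) * (a + 3))) := by
  set d := (a + 1) * (a + 2) * (a + 3) with hd
  have hd0 : 0 < d := by positivity
  have hcm := measurable_covRatio
  have hrm := measurable_remRatio
  have hci : Measurable fun u => ∫⁻ v in Set.Ioo (0 : ℝ) 1, ENNReal.ofReal (covRatio u v) :=
    (hcm.ennreal_ofReal).lintegral_prod_right'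
  have hri : Measurable fun u => ∫⁻ v in Set.Ioo (0 : ℝ) 1, ENNReal.ofReal (remRatio u v) :=
    (hrm.ennreal_ofReal).lintegral_prod_right'
  have hcu : ∀ u, Measurable fun v => ENNReal.ofReal (covRatio u v) := fun u =>
    (hcm.comp measurable_prodMk_left).ennreal_ofReal
  have hru : ∀ u, Measurable fun v => ENNReal.ofReal (remRatio u v) := fun u =>
    (hrm.comp measurable_prodMk_left).ennreal_ofReal
  have hpi : (0 : ℝ) ≤ Real.pi ^ 2 / 3 - 3 := by nlinarith [Real.pi_gt_three]
  calc
    _ = ∫⁻ u in Set.Ioo (0 : ℝ) 1, ∫⁻ v in Set.Ioo (0 : ℝ) 1,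
        (ENNReal.ofReal (a / d) + ENNReal.ofReal (2 * a / d) * ENNReal.ofReal (covRatio u v) +
          ENNReal.ofReal (6 / d) * ENNReal.ofReal (remRatio u v)) := by
      refine setLIntegral_congr_fun measurableSet_Ioo fun u hu =>
        setLIntegral_congr_fun measurableSet_Ioo fun v hv => ?_
      have h1 := covRatio_nonneg hu hv
      have h2 := remRatio_nonneg hu hv
      rw [← ENNReal.ofReal_mul (by positivity), ← ENNReal.ofReal_mul (by positivity),
        ← ENNReal.ofReal_add (by positivity) (by positivity),
        ← ENNReal.ofReal_add (by positivity) (by positivity)]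
      congr 1
      ring
    -- The terms in `a` combine to `a (1 + 2(π²/3 - 3)) = a (2π²/3 - 5)`.
    _ = ENNReal.ofReal (a / d) + ENNReal.ofReal (2 * a / d) * ENNReal.ofReal (Real.pi ^ 2 / 3 - 3) +
          ENNReal.ofReal (6 / d) * ENNReal.ofReal remConst := by
      have : ∀ u, ∫⁻ v in Set.Ioo (0 : ℝ) 1,
        (ENNReal.ofReal (a / d) + ENNReal.ofReal (2 * a / d) * ENNReal.ofReal (covRatio u v) +
          ENNReal.ofReal (6 / d) * ENNReal.ofReal (remRatio u v)) =
          ENNReal.ofReal (a / d) + ENNReal.ofReal (2 * a / d) *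
            (∫⁻ v in Set.Ioo (0 : ℝ) 1, ENNReal.ofReal (covRatio u v)) +
          ENNReal.ofReal (6 / d) * ∫⁻ v in Set.Ioo (0 : ℝ) 1, ENNReal.ofReal (remRatio u v) := by
        intro u
        rw [lintegral_add_right _ ((hru u).const_mul _), lintegral_add_right _ ((hcu u).const_mul _),
          lintegral_const_mul _ (hru u), lintegral_const_mul _ (hcu u)]
        simp
      simp only [this]
      rw [lintegral_add_right _ (hri.const_mul _), lintegral_add_right _ (hci.const_mul _),
        lintegral_const_mul _ hri, lintegral_const_mul _ hci, lintegral_covRatio, remConst,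
        ENNReal.ofReal_toReal lintegral_remRatio_ne_top]
      simp
    _ = _ := by
      have : 0 ≤ remConst := ENNReal.toReal_nonneg
      rw [← ENNReal.ofReal_mul (by positivity), ← ENNReal.ofReal_mul (by positivity),
        ← ENNReal.ofReal_add (by positivity) (by positivity),
        ← ENNReal.ofReal_add (by positivity) (by positivity)]
      congr 1
      ring

/-- The square is written as a double integral over two copies of `T`, and Tonelli moves the
expectation inside. -/
lemma lintegral_sq_lintegral {Ω T : Type*} [MeasurableSpace Ω] [MeasurableSpace T]
    (μ : Measure Ω) [SFinite μ] (H : Measure T) [SFinite H] {φ : Ω → T → ℝ≥0∞}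
    (hφ : Measurable (Function.uncurry φ)) :
    ∫⁻ ω, (∫⁻ t, φ ω t ∂H) ^ 2 ∂μ = ∫⁻ s, ∫⁻ t, ∫⁻ ω, φ ω s * φ ω t ∂μ ∂H ∂H := by
  have hφu : ∀ ω, Measurable (φ ω) := fun ω => hφ.comp measurable_prodMk_left
  have hφt : ∀ t, Measurable fun ω => φ ω t := fun t => hφ.comp measurable_prodMk_right
  have h3 : Measurable fun q : (Ω × T) × T => φ q.1.1 q.1.2 * φ q.1.1 q.2 :=
    (hφ.comp measurable_fst).mul
      (hφ.comp ((measurable_fst.comp measurable_fst).prodMk measurable_snd))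
  calc
    _ = ∫⁻ ω, ∫⁻ s, ∫⁻ t, φ ω s * φ ω t ∂H ∂H ∂μ := by
      refine lintegral_congr fun ω => ?_
      rw [sq, ← lintegral_mul_const _ (hφu ω)]
      exact lintegral_congr fun s => (lintegral_const_mul _ (hφu ω)).symm
    _ = ∫⁻ s, ∫⁻ ω, ∫⁻ t, φ ω s * φ ω t ∂H ∂μ ∂H :=
      lintegral_lintegral_swap h3.lintegral_prod_right'.aemeasurable
    _ = ∫⁻ s, ∫⁻ t, ∫⁻ ω, φ ω s * φ ω t ∂μ ∂H ∂H := by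
      refine lintegral_congr fun s => lintegral_lintegral_swap (Measurable.aemeasurable ?_)
      exact ((hφt s).comp measurable_fst).mul hφ

namespace IsDirichletProcess

variable {Ω : Type*} [MeasurableSpace Ω] {a : ℝ} {H : Measure ℝ}
  {P : Kernel Ω ℝ} {μ : Measure Ω}

lemma measurable_adDist [IsProbabilityMeasure H] (hP : IsDirichletProcess a H P μ) :
    Measurable fun ω => adDist (cdf (P ω)) (cdf H) := by
  simp only [adDist_cdf_eq_toReal]
  exact (Measurable.lintegral_prod_right' hP.measurable_adIntegrand.ennreal_ofReal).ennreal_toReal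

variable [IsProbabilityMeasure H] [NullSingletonClass H] [IsProbabilityMeasure μ]

lemma lintegral_lintegral_adIntegrand (hP : IsDirichletProcess a H P μ) (ha : 0 < a) :
    ∫⁻ ω, ∫⁻ t, ENNReal.ofReal (adIntegrand (cdf (P ω)) (cdf H) t) ∂H ∂μ =
      ENNReal.ofReal (1 / (a + 1)) := by
  rw [lintegral_lintegral_swap hP.measurable_adIntegrand.ennreal_ofReal.aemeasurable,
    lintegral_congr_ae (g := fun _ => ENNReal.ofReal (1 / (a + 1)))]
  · simp
  · filter_upwards [ae_cdf_mem_Ioo H] with t ht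
    exact hP.lintegral_adIntegrand ha ht.1 ht.2

lemma ae_lintegral_adIntegrand_lt_top (hP : IsDirichletProcess a H P μ) (ha : 0 < a) :
    ∀ᵐ ω ∂μ, ∫⁻ t, ENNReal.ofReal (adIntegrand (cdf (P ω)) (cdf H) t) ∂H < ⊤ := by
  refine ae_lt_top (Measurable.lintegral_prod_right' hP.measurable_adIntegrand.ennreal_ofReal) ?_
  rw [hP.lintegral_lintegral_adIntegrand ha]
  exact ENNReal.ofReal_ne_top

lemma ae_integrable_adIntegrand (hP : IsDirichletProcess a H P μ) (ha : 0 < a) :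
    ∀ᵐ ω ∂μ, Integrable (adIntegrand (cdf (P ω)) (cdf H)) (cdf H).measure := by
  filter_upwards [hP.ae_lintegral_adIntegrand_lt_top ha] with ω hω
  rw [measure_cdf]
  exact (lintegral_ofReal_ne_top_iff_integrable
    (measurable_adIntegrand_cdf _ _).aestronglyMeasurable
    (ae_of_all _ (adIntegrand_cdf_nonneg _ _))).1 hω.ne

lemma lintegral_sq_lintegral_adIntegrand (hP : IsDirichletProcess a H P μ) (ha : 0 < a) :
    ∫⁻ ω, (∫⁻ t, ENNReal.ofReal (adIntegrand (cdf (P ω)) (cdf H) t) ∂H) ^ 2 ∂μ =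
      ENNReal.ofReal ((a * (2 / 3 * Real.pi ^ 2 - 5) + 6 * remConst) /
        ((a + 1) * (a + 2) * (a + 3))) := by
  rw [lintegral_sq_lintegral μ H
    (φ := fun ω t => ENNReal.ofReal (adIntegrand (cdf (P ω)) (cdf H) t))
    hP.measurable_adIntegrand.ennreal_ofReal]
  calc
    _ = ∫⁻ s, ∫⁻ t, ENNReal.ofReal ((a * (1 + 2 * covRatio (cdf H s) (cdf H t)) +
        6 * remRatio (cdf H s) (cdf H t)) / ((a + 1) * (a + 2) * (a + 3))) ∂H ∂H := by
      refine lintegral_congr_ae ?_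
      filter_upwards [ae_cdf_mem_Ioo H] with s hs
      refine lintegral_congr_ae ?_
      filter_upwards [ae_cdf_mem_Ioo H] with t ht
      exact hP.lintegral_adIntegrand_mul_adIntegrand ha hs.1 hs.2 ht.1 ht.2
    _ = _ := by
      rw [lintegral_lintegral_comp_cdf H (f := fun p => ENNReal.ofReal
        ((a * (1 + 2 * covRatio p.1 p.2) + 6 * remRatio p.1 p.2) / ((a + 1) * (a + 2) * (a + 3))))]
      · exact lintegral_covRatio_remRatio ha
      · have := measurable_covRatio
        have := measurable_remRatio
        fun_prop

lemma lintegral_enorm_adDist_sq (hP : IsDirichletProcess a H P μ) (ha : 0 < a) :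
    ∫⁻ ω, ‖adDist (cdf (P ω)) (cdf H)‖ₑ ^ 2 ∂μ =
      ENNReal.ofReal ((a * (2 / 3 * Real.pi ^ 2 - 5) + 6 * remConst) /
        ((a + 1) * (a + 2) * (a + 3))) := by
  rw [← hP.lintegral_sq_lintegral_adIntegrand ha]
  refine lintegral_congr_ae ?_
  filter_upwards [hP.ae_lintegral_adIntegrand_lt_top ha] with ω hω
  rw [adDist_cdf_eq_toReal, Real.enorm_of_nonneg ENNReal.toReal_nonneg, ENNReal.ofReal_toReal hω.ne]

lemma eLpNorm_adDist (hP : IsDirichletProcess a H P μ) (ha : 0 < a) :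
    eLpNorm (fun ω => adDist (cdf (P ω)) (cdf H)) 2 μ =
      ENNReal.ofReal ((a * (2 / 3 * Real.pi ^ 2 - 5) + 6 * remConst) /
        ((a + 1) * (a + 2) * (a + 3))) ^ (1 / 2 : ℝ) := by
  rw [eLpNorm_eq_lintegral_rpow_enorm_toReal (by norm_num) (by norm_num),
    ← hP.lintegral_enorm_adDist_sq ha]
  simp

lemma memLp_adDist (hP : IsDirichletProcess a H P μ) (ha : 0 < a) :
    MemLp (fun ω => adDist (cdf (P ω)) (cdf H)) 2 μ := by
  refine ⟨hP.measurable_adDist.aestronglyMeasurable, ?_⟩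
  rw [hP.eLpNorm_adDist ha]
  finiteness

lemma integral_adDist (hP : IsDirichletProcess a H P μ) (ha : 0 < a) :
    ∫ ω, adDist (cdf (P ω)) (cdf H) ∂μ = 1 / (a + 1) := by
  simp only [adDist_cdf_eq_toReal]
  rw [integral_toReal (Measurable.lintegral_prod_right'
      hP.measurable_adIntegrand.ennreal_ofReal).aemeasurable
      (hP.ae_lintegral_adIntegrand_lt_top ha), hP.lintegral_lintegral_adIntegrand ha,
    ENNReal.toReal_ofReal (by positivity)]

lemma integral_adDist_sq (hP : IsDirichletProcess a H P μ) (ha : 0 < a) :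
    ∫ ω, adDist (cdf (P ω)) (cdf H) ^ 2 ∂μ =
      (a * (2 / 3 * Real.pi ^ 2 - 5) + 6 * remConst) / ((a + 1) * (a + 2) * (a + 3)) := by
  have hr : 0 ≤ remConst := ENNReal.toReal_nonneg
  have hpi : (0 : ℝ) ≤ 2 / 3 * Real.pi ^ 2 - 5 := by nlinarith [Real.pi_gt_three]
  rw [integral_eq_lintegral_of_nonneg_ae (ae_of_all _ fun _ => sq_nonneg _)
    (hP.measurable_adDist.pow_const 2).aestronglyMeasurable]
  rw [← ENNReal.toReal_ofReal (r := (a * (2 / 3 * Real.pi ^ 2 - 5) + 6 * remConst) / _)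
    (by positivity), ← hP.lintegral_enorm_adDist_sq ha]
  congr 1
  refine lintegral_congr fun ω => ?_
  rw [← Real.enorm_of_nonneg (sq_nonneg _), enorm_pow]

lemma variance_adDist (hP : IsDirichletProcess a H P μ) (ha : 0 < a) :
    variance (fun ω => adDist (cdf (P ω)) (cdf H)) μ =
      (a * (2 / 3 * Real.pi ^ 2 - 5) + 6 * remConst) / ((a + 1) * (a + 2) * (a + 3)) -
        1 / (a + 1) ^ 2 := by
  rw [variance_eq_sub (hP.memLp_adDist ha), hP.integral_adDist ha]
  simp only [Pi.pow_apply]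
  rw [hP.integral_adDist_sq ha, div_pow, one_pow]

end IsDirichletProcess

/-! ### The chi-square base measure (only its total mass and lack of atoms matter) and limits in `a`
-/

instance (m : ℕ) : NullSingletonClass (chiSquare m) := by
  unfold chiSquare gammaMeasure; infer_instance

lemma isProbabilityMeasure_chiSquare {m : ℕ} (hm : 1 ≤ m) :
    IsProbabilityMeasure (chiSquare m) := by
  have : (0 : ℝ) < m := by exact_mod_cast hm
  exact isProbabilityMeasure_gammaMeasure (by positivity) (by norm_num)

lemma tendsto_inv_add_atTop (b : ℝ) : Tendsto (fun a : ℝ => 1 / (a + b)) atTop (𝓝 0) := by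
  simp only [one_div]
  exact (tendsto_atTop_add_const_right _ b tendsto_id).inv_tendsto_atTop

lemma tendsto_div_add_mul_add (b c : ℝ) :
    Tendsto (fun a : ℝ => (a * b + c) / ((a + 2) * (a + 3))) atTop (𝓝 0) := by
  -- Division of the numerator: `a b + c = b (a + 3) + (c - 3 b)`.
  have h : Tendsto (fun a : ℝ => b * (1 / (a + 2)) +
      (c - 3 * b) * (1 / (a + 2) * (1 / (a + 3)))) atTop
      (𝓝 (b * 0 + (c - 3 * b) * (0 * 0))) :=
    ((tendsto_inv_add_atTop 2).const_mul b).add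
      (((tendsto_inv_add_atTop 2).mul (tendsto_inv_add_atTop 3)).const_mul _)
  simp only [mul_zero, add_zero] at h
  refine h.congr' ?_
  filter_upwards [eventually_gt_atTop 0] with a ha
  field_simp
  ring

lemma tendsto_add_one_mul_div (b c : ℝ) :
    Tendsto (fun a : ℝ => (a + 1) * ((a * b + c) / ((a + 2) * (a + 3)))) atTop (𝓝 b) := by
  -- Polynomial division of `(a + 1)(a b + c)` by `(a + 2)(a + 3)`, with quotient `b`.
  have h : Tendsto (fun a : ℝ => b + ((a * (c - 4 * b) + (c - 6 * b)) / ((a + 2) * (a + 3)))) atTop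
      (𝓝 (b + 0)) := tendsto_const_nhds.add (tendsto_div_add_mul_add _ _)
  rw [add_zero] at h
  refine h.congr' ?_
  filter_upwards [eventually_gt_atTop 0] with a ha
  field_simp
  ring

lemma tendsto_secondMoment (b c : ℝ) :
    Tendsto (fun a : ℝ => (a * b + c) / ((a + 1) * (a + 2) * (a + 3))) atTop (𝓝 0) := by
  have h := (tendsto_inv_add_atTop 1).mul (tendsto_div_add_mul_add b c)
  rw [mul_zero] at h
  refine h.congr' ?_
  filter_upwards [eventually_gt_atTop 0] with a ha
  field_simp

/-- A sequence of random variables with summable second moments tends to `0` almost surely. -/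
lemma ae_tendsto_zero_of_tsum_lintegral_sq_ne_top {Ω : Type*} [MeasurableSpace Ω] {μ : Measure Ω}
    {X : ℕ → Ω → ℝ} (hX : ∀ k, Measurable (X k))
    (h : ∑' k, ∫⁻ ω, ‖X k ω‖ₑ ^ 2 ∂μ ≠ ⊤) :
    ∀ᵐ ω ∂μ, Tendsto (fun k => X k ω) atTop (𝓝 0) := by
  rw [← lintegral_tsum fun k => ((hX k).enorm.pow_const 2).aemeasurable] at h
  filter_upwards [ae_lt_top (Measurable.tsum fun k => (hX k).enorm.pow_const 2) h] with ω hω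
  have h2 := ENNReal.tendsto_atTop_zero_of_tsum_ne_top hω.ne
  have h3 := h2.ennrpow_const (1 / 2)
  rw [tendsto_zero_iff_enorm_tendsto_zero]
  convert h3 using 2 with k
  · rw [← ENNReal.rpow_natCast, ← ENNReal.rpow_mul]
    norm_num
  · norm_num

/-- The numerator is at most `(b + c)(x + 1)`, which cancels one factor of the denominator and
leaves a multiple of `x⁻²`, uniformly in `k`. -/
lemma secondMoment_le {b c d : ℝ} (hb : 0 ≤ b) (hc : 0 ≤ c) (hd : 0 < d) {k : ℕ} :
    (((k : ℝ) + 1) * d * b + c) / ((((k : ℝ) + 1) * d + 1) * (((k : ℝ) + 1) * d + 2) *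
      (((k : ℝ) + 1) * d + 3)) ≤ (b + c) / d ^ 2 * (1 / ((k : ℝ) + 1) ^ 2) := by
  set x := ((k : ℝ) + 1) * d with hx
  have hx0 : 0 < x := by positivity
  have e : (b + c) / d ^ 2 * (1 / ((k : ℝ) + 1) ^ 2) = (b + c) / x ^ 2 := by
    rw [hx]; field_simp
  rw [e, div_le_div_iff₀ (by positivity) (by positivity)]
  have h1 : x * b + c ≤ (b + c) * (x + 1) := by nlinarith [mul_nonneg hc hx0.le]
  have h2 : (x + 1) * x ^ 2 ≤ (x + 1) * (x + 2) * (x + 3) := by nlinarith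
  calc (x * b + c) * x ^ 2 ≤ (b + c) * (x + 1) * x ^ 2 := by gcongr
    _ = (b + c) * ((x + 1) * x ^ 2) := by ring
    _ ≤ _ := by gcongr

lemma IsDirichletProcess.ae_tendsto_adDist {Ω : Type*} [MeasurableSpace Ω] {μ : Measure Ω}
    [IsProbabilityMeasure μ] {H : Measure ℝ} [IsProbabilityMeasure H] [NullSingletonClass H]
    {c : ℝ} (hc : 0 < c) {P : ℕ → Kernel Ω ℝ}
    (hP : ∀ k : ℕ, 1 ≤ k → IsDirichletProcess (k * c) H (P k) μ) :
    ∀ᵐ ω ∂μ, Tendsto (fun k => adDist (cdf (P k ω)) (cdf H)) atTop (𝓝 0) := by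
  have hr : 0 ≤ remConst := ENNReal.toReal_nonneg
  have hpi : (0 : ℝ) ≤ 2 / 3 * Real.pi ^ 2 - 5 := by nlinarith [Real.pi_gt_three]
  -- The index is shifted because nothing is assumed about `P 0`; the limit is unaffected.
  have hP' : ∀ k : ℕ, IsDirichletProcess (((k : ℝ) + 1) * c) H (P (k + 1)) μ := fun k => by
    simpa using hP (k + 1) (by omega)
  have h := ae_tendsto_zero_of_tsum_lintegral_sq_ne_top (μ := μ)
    (fun k => (hP' k).measurable_adDist) (by
      simp only [(hP' _).lintegral_enorm_adDist_sq (by positivity : 0 < ((_ : ℕ) + 1 : ℝ) * c)]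
      refine ne_top_of_le_ne_top (b := ∑' k : ℕ, ENNReal.ofReal
        ((2 / 3 * Real.pi ^ 2 - 5 + 6 * remConst) / c ^ 2 * (1 / ((k : ℝ) + 1) ^ 2))) ?_
        (ENNReal.tsum_le_tsum fun k => ENNReal.ofReal_le_ofReal
          (secondMoment_le hpi (by positivity) hc))
      have hs : Summable fun k : ℕ => (1 : ℝ) / ((k : ℝ) + 1) ^ 2 := by
        simpa using (summable_nat_add_iff 1).2 hasSum_zeta_two.summable
      exact (hs.mul_left _).tsum_ofReal_ne_top)
  filter_upwards [h] with ω hω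
  exact (tendsto_add_atTop_iff_nat 1).1 hω

theorem mainTheorem4 (m : ℕ) (hm : 1 ≤ m) :
    -- For Dirichlet processes `P a ∼ DP(a, F_(m))`, `a > 0`, on arbitrary probability spaces:
    (∀ {Ω : ℝ → Type*} [∀ a, MeasurableSpace (Ω a)] (μ : ∀ a, Measure (Ω a))
        [∀ a, IsProbabilityMeasure (μ a)] (P : ∀ a, Kernel (Ω a) ℝ),
        (∀ a, 0 < a → IsDirichletProcess a (chiSquare m) (P a) (μ a)) →
        -- the distance is almost surely finite and square integrable
        (∀ a, 0 < a →
          (∀ᵐ ω ∂μ a, Integrable (adIntegrand (cdf (P a ω)) (cdf (chiSquare m)))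
            (cdf (chiSquare m)).measure) ∧
          MemLp (fun ω => adDist (cdf (P a ω)) (cdf (chiSquare m))) 2 (μ a)) ∧
        -- (i)
        Tendsto (fun a => ∫ ω, adDist (cdf (P a ω)) (cdf (chiSquare m)) ∂μ a) atTop (𝓝 0) ∧
        Tendsto (fun a => variance (fun ω => adDist (cdf (P a ω)) (cdf (chiSquare m))) (μ a))
          atTop (𝓝 0) ∧
        -- (ii)
        Tendsto (fun a => ∫ ω, (a + 1) * adDist (cdf (P a ω)) (cdf (chiSquare m)) ∂μ a)
          atTop (𝓝 1) ∧
        Tendsto (fun a =>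
            variance (fun ω => (a + 1) * adDist (cdf (P a ω)) (cdf (chiSquare m))) (μ a))
          atTop (𝓝 (2 / 3 * (Real.pi ^ 2 - 9))) ∧
        -- (iii), convergence in quadratic mean
        Tendsto (fun a => eLpNorm (fun ω => adDist (cdf (P a ω)) (cdf (chiSquare m)) - 0) 2 (μ a))
          atTop (𝓝 0)) ∧
    -- (iii), almost sure convergence along `a = k c`, `k = 1, 2, …`
    (∀ {Ω : Type*} [MeasurableSpace Ω] (μ : Measure Ω) [IsProbabilityMeasure μ]
        (c : ℝ) (_ : 0 < c) (P : ℕ → Kernel Ω ℝ),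
        (∀ k : ℕ, 1 ≤ k → IsDirichletProcess (k * c) (chiSquare m) (P k) μ) →
        ∀ᵐ ω ∂μ, Tendsto (fun k => adDist (cdf (P k ω)) (cdf (chiSquare m))) atTop (𝓝 0)) := by
  have := isProbabilityMeasure_chiSquare hm
  refine ⟨?_, fun μ _ c hc P hP => IsDirichletProcess.ae_tendsto_adDist hc hP⟩
  intro Ω _ μ _ P hP
  have hE : ∀ a, 0 < a → ∫ ω, adDist (cdf (P a ω)) (cdf (chiSquare m)) ∂μ a = 1 / (a + 1) :=
    fun a ha => (hP a ha).integral_adDist ha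
  have hV := fun a (ha : 0 < a) => (hP a ha).variance_adDist ha
  refine ⟨fun a ha => ⟨(hP a ha).ae_integrable_adIntegrand ha, (hP a ha).memLp_adDist ha⟩,
    ?_, ?_, ?_, ?_, ?_⟩
  · refine (tendsto_inv_add_atTop 1).congr' ?_
    filter_upwards [eventually_gt_atTop 0] with a ha
    exact (hE a ha).symm
  · have h := (tendsto_secondMoment (2 / 3 * Real.pi ^ 2 - 5) (6 * remConst)).sub
      ((tendsto_inv_add_atTop 1).pow 2)
    norm_num only at h
    refine h.congr' ?_
    filter_upwards [eventually_gt_atTop 0] with a ha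
    rw [hV a ha, div_pow, one_pow]
  · refine (tendsto_const_nhds (x := (1 : ℝ))).congr' ?_
    filter_upwards [eventually_gt_atTop 0] with a ha
    rw [integral_const_mul, hE a ha]
    field_simp
  -- Scaling multiplies the variance by `(a + 1)²`: one factor `a + 1` survives in the second
  -- moment, and the squared mean becomes `1`.
  · have h := (tendsto_add_one_mul_div (2 / 3 * Real.pi ^ 2 - 5) (6 * remConst)).sub_const 1
    rw [show 2 / 3 * Real.pi ^ 2 - 5 - 1 = 2 / 3 * (Real.pi ^ 2 - 9) by ring] at h
    refine h.congr' ?_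
    filter_upwards [eventually_gt_atTop 0] with a ha
    rw [variance_const_mul, hV a ha]
    field_simp
  · simp only [sub_zero]
    -- The `L²` norm is the square root of the second moment, and the square root is continuous at
    -- `0`.
    have h := ((ENNReal.continuous_rpow_const (y := 1 / 2)).comp ENNReal.continuous_ofReal).tendsto 0
      |>.comp (tendsto_secondMoment (2 / 3 * Real.pi ^ 2 - 5) (6 * remConst))
    simp only [Function.comp_apply, ENNReal.ofReal_zero] at h
    rw [ENNReal.zero_rpow_of_pos (by norm_num)] at h
    refine h.congr' ?_
    filter_upwards [eventually_gt_atTop 0] with a ha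
    exact ((hP a ha).eLpNorm_adDist ha).symm
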